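/- Let $d\ge 1$ and let $\mathcal E(\rho)=\sum_{i=1}^{d^2}\mathcal A_i\rho\mathcal A_i^\dagger$ be a completely positive map on $\mathbb C^{d\times d}$ with $\sum_i\mathcal A_i^\dagger\mathcal A_i\le I_d$ (trace-preserving, TP, if equality holds). Let $E_{(j,k)}=|j\rangle\langle k|$ (ordered by $(j-1)d+k$) and $\sigma_n=|j\rangle\langle k|$ with $n=(k-1)d+j$ be the natural bases. Let $X\ge 0$ be the $d^2\times d^2$ process matrix, $\mathcal E(\rho)=\sum_{j,k}X_{jk}E_j\rho E_k^\dagger$, and let $F=\operatorname{Tr}_1(X)$ be its partial trace over the first factor of $\mathbb C^d\otimes\mathbb C^d$. Let $\|\cdot\|$ be the Frobenius norm and $\operatorname{vec}$ the column-stacking vectorization. Experiment: there are $M$ input states $\rho_1,\dots,\rho_M$ spanning $\mathbb C^{d\times d}$, with $V=[\operatorname{vec}\rho_1,\dots,\operatorname{vec}\rho_M]$, and $J$ POVM sets $\{P_{i,j}\}_{i=1}^{n_j}$, $\sum_iP_{i,j}=I_d$, whose elements, listed as $P_1,\dots,P_L$, together span $\mathbb C^{d\times d}$; $C$ is the $L\times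 d^2$ matrix $C_{ln}=\operatorname{Tr}(\sigma_nP_l)$. For each input state $N$ copies are used, $\lfloor N/J\rfloor$ of them for each POVM set. All measurements are independent; for input $m$ and POVM set $j$ the outcome $i$ has probability $\operatorname{Tr}(\mathcal E(\rho_m)P_{i,j})$, and with the remaining probability $1-\operatorname{Tr}\mathcal E(\rho_m)$ no outcome is registered. $\hat p_{ml}$ is the observed relative frequency among the $\lfloor N/J\rfloor$ copies, $\hat{\mathcal P}=(\hat p_{ml})$, and $\mathbb E$ is the expectation over all measurement results. Two-stage (TSS) estimator $\hat X$: (1) $\hat A^T=(C^\dagger C)^{-1}C^\dagger\hat{\mathcal P}^T$. (2) $\operatorname{vec}\hat D=(B^\dagger B)^{-1}B^\dagger\operatorname{vec}\hat A$, where the row of $B$ with index $(n,m)$ and its column with index $(k,j)$ hold the coefficient of $\sigma_n$ in $E_j\rho_mE_k^\dagger$. (3) $\hat G$ is the positive semidefinite matrix nearest to $\hat D$: the negative eigenvalues of $(\hat D+\hat D^\dagger)/2$ are replaced by $0$. (4) Put $\hat F=\operatorname{Tr}_1(\hat G)$; $\bar F$ arises from $\hat F$ by replacing its zero eigenvalues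 by $\hat f_c/N$, where $\hat f_c$ is the smallest positive eigenvalue of $\hat F$, and $\tilde F$ arises from $\bar F$ by replacing every eigenvalue $f$ by $\min(f,1)$; then $\hat X=(I_d\otimes\tilde F^{1/2}\bar F^{-1/2})\,\hat G\,(I_d\otimes\tilde F^{1/2}\bar F^{-1/2})^\dagger$ (and $\hat X=0$ if $\hat F=0$). Then $$\mathbb E\|\hat X-X\|=O\!\left(\frac{\sqrt d\,\operatorname{Tr}(F)\,\sqrt{J\operatorname{Tr}\big((C^\dagger C)^{-1}\big)}\,\sqrt{M\operatorname{Tr}\big((V^*V^T)^{-1}\big)}}{\sqrt N}\right)\qquad(N\to\infty)$$ in the following sense. For every $\delta>0$ there is a constant $K$ depending on $\delta$ only such that, for all $d,M,J,n_1,\dots,n_J$, all such input states and POVM sets, and all such processes with $\sqrt d\operatorname{Tr}(F)\ge\delta$ or $X=0$, the left side is at most $K$ times the expression in brackets for all sufficiently large $N$. If moreover the process is TP, then $\operatorname{Tr}(F)=d$, and with an absolute constant $K$ the left side is, for all sufficiently large $N$, at most $$K\,\frac{d^{3/2}\sqrt{J\operatorname{Tr}\big((C^\dagger C)^{-1}\big)}\,\sqrt{M\operatorname{Tr}\big((V^*V^T)^{-1}\big)}}{\sqrt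 N}.$$ -/

import Mathlib

noncomputable section

open scoped ComplexOrder

namespace QPT

/-- Operators on a `d`-dimensional system. -/
abbrev Op (d : ℕ) := Matrix (Fin d) (Fin d) ℂ

/-- Operators on `ℍ₁ ⊗ ℍ₂` with `ℍ₁ = ℍ₂ = ℂ^d`. `Matrix.vec` is the column-stacking vectorization
and is indexed by (column, row), i.e. by the index set of `ℍ₁ ⊗ ℍ₂`. -/
abbrev BiOp (d : ℕ) := Matrix (Fin d × Fin d) (Fin d × Fin d) ℂ

/-- The Frobenius norm. -/
def frobNorm {m n : Type} [Fintype m] [Fintype n] (A : Matrix m n ℂ) : ℝ :=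
  Real.sqrt (∑ i, ∑ j, ‖A i j‖ ^ 2)

/-- The partial trace over the first factor. -/
def partialTrace₁ {d : ℕ} (X : BiOp d) : Op d :=
  Matrix.of fun a b => ∑ k, X (k, a) (k, b)

/-- The natural basis `E_i = |j⟩⟨k|` with `i = (j-1)d + k`, i.e. `i ↔ (j, k)`. -/
def basisE {d : ℕ} (i : Fin d × Fin d) : Op d := Matrix.single i.1 i.2 1

/-- The natural basis `σ_n = |j⟩⟨k|` with `n = (k-1)d + j`, i.e. `n ↔ (k, j)`. The coefficients of
an operator in this basis are the entries of its vectorization. -/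
def basisσ {d : ℕ} (n : Fin d × Fin d) : Op d := Matrix.single n.2 n.1 1

/-- A quantum process: a completely positive map in Kraus form, trace non-increasing. -/
structure Channel (d : ℕ) where
  kraus : Fin (d ^ 2) → Op d
  sum_le_one : (1 - ∑ i, (kraus i).conjTranspose * kraus i).PosSemidef

/-- The action of the process. -/
def Channel.apply {d : ℕ} (T : Channel d) (ρ : Op d) : Op d :=
  ∑ i, T.kraus i * ρ * (T.kraus i).conjTranspose

/-- The process is trace-preserving. -/
def Channel.IsTP {d : ℕ} (T : Channel d) : Prop :=
  ∑ i, (T.kraus i).conjTranspose * T.kraus i = 1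

/-- `X` is the process matrix of `T` with respect to the natural basis `E`. -/
structure IsProcessMatrix {d : ℕ} (T : Channel d) (X : BiOp d) : Prop where
  posSemidef : X.PosSemidef
  apply_eq : ∀ ρ : Op d, T.apply ρ =
    ∑ j, ∑ k, X j k • (basisE j * ρ * (basisE k).conjTranspose)

/-- The experimental configuration: `M` input states and `J` POVM sets, the `j`-th one with `n j`
elements, both informationally complete or overcomplete. -/
structure Config (d M J : ℕ) (n : Fin J → ℕ) where
  ρ : Fin M → Op d
  ρ_posSemidef : ∀ m, (ρ m).PosSemidef
  ρ_trace : ∀ m, (ρ m).trace = 1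
  ρ_complete : Submodule.span ℂ (Set.range ρ) = ⊤
  P : (j : Fin J) → Fin (n j) → Op d
  P_posSemidef : ∀ j i, (P j i).PosSemidef
  P_sum : ∀ j, ∑ i, P j i = 1
  P_complete : Submodule.span ℂ (Set.range fun l : (j : Fin J) × Fin (n j) => P l.1 l.2) = ⊤

namespace Config

variable {d M J : ℕ} {n : Fin J → ℕ} (S : Config d M J n)

/-- `V = [vec ρ₁, …, vec ρ_M]`. -/
def V : Matrix (Fin d × Fin d) (Fin M) ℂ := Matrix.of fun a m => (S.ρ m).vec a

/-- The matrix of the measurement operators, `C_{l n} = Tr (σ_n P_l)`. -/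
def C : Matrix ((j : Fin J) × Fin (n j)) (Fin d × Fin d) ℂ :=
  Matrix.of fun l a => (basisσ a * S.P l.1 l.2).trace

/-- The matrix `B` with `B vec(X) = vec(A)`. Its row index is that of `vec A` (`A` being
`M × d²`) and its column index that of `vec X`. The entry is the coefficient of
`E_j ρ_m E_k†` at `σ_a`. -/
def B : Matrix ((Fin d × Fin d) × Fin M) ((Fin d × Fin d) × (Fin d × Fin d)) ℂ :=
  Matrix.of fun am kj => (basisE kj.2 * S.ρ am.2 * (basisE kj.1).conjTranspose).vec am.1

/-- `Tr ((C† C)⁻¹)`. -/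
def trC : ℝ := (S.C.conjTranspose * S.C)⁻¹.trace.re

/-- `Tr ((V* Vᵀ)⁻¹)`. -/
def trV : ℝ := (S.V.map star * S.V.transpose)⁻¹.trace.re

/-! ### Measurement statistics -/

/-- The probability of the outcomes when the `j`-th POVM is measured on the output for the `m`-th
input: `Tr (E(ρ_m) P_{i,j})` for the outcome `i`, and the remaining probability `1 - Tr E(ρ_m)`
(zero for a trace-preserving process) for the event `none` that the process gives no output. -/
def outcomeProb (T : Channel d) (m : Fin M) (j : Fin J) : Option (Fin (n j)) → ℝ
  | some i => (T.apply (S.ρ m) * S.P j i).trace.re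
  | none => 1 - (T.apply (S.ρ m)).trace.re

/-- The possible records of the whole experiment with `N` copies for each input state, shared
equally among the `J` POVM sets. -/
abbrev Record (M J : ℕ) (n : Fin J → ℕ) (N : ℕ) :=
  (m : Fin M) → (j : Fin J) → Fin (N / J) → Option (Fin (n j))

/-- The probability of a record: all measurements are independent. -/
def recordProb (T : Channel d) {N : ℕ} (ω : Record M J n N) : ℝ :=
  ∏ m, ∏ j, ∏ c, S.outcomeProb T m j (ω m j c)

/-- The observed frequencies `p̂_{m l}`. -/
def freq {N : ℕ} (ω : Record M J n N) : Matrix (Fin M) ((j : Fin J) × Fin (n j)) ℂ :=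
  Matrix.of fun m l =>
    ((Finset.univ.filter fun c => ω m l.1 c = some l.2).card : ℂ) / ((N / J : ℕ) : ℂ)

/-! ### The two-stage estimator -/

/-- Step 1: `Â`, from the linear inversion `Âᵀ = (C† C)⁻¹ C† P̂ᵀ`. -/
def estA (p : Matrix (Fin M) ((j : Fin J) × Fin (n j)) ℂ) : Matrix (Fin M) (Fin d × Fin d) ℂ :=
  ((S.C.conjTranspose * S.C)⁻¹ * S.C.conjTranspose * p.transpose).transpose

/-- Step 2: `D̂`, the least squares solution `vec D̂ = (B† B)⁻¹ B† vec Â`. -/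
def estD (p : Matrix (Fin M) ((j : Fin J) × Fin (n j)) ℂ) : BiOp d :=
  Matrix.of fun j k =>
    (((S.B.conjTranspose * S.B)⁻¹ * S.B.conjTranspose).mulVec (S.estA p).vec) (k, j)

end Config

/-- Step 3: the positive semidefinite matrix nearest to `D`: the negative eigenvalues of the
Hermitian part of `D` are replaced by zero (`cfc f A` applies `f` to the eigenvalues of `A`). -/
def projPSD {d : ℕ} (D : BiOp d) : BiOp d :=
  cfc (fun x : ℝ => max x 0) ((1 / 2 : ℂ) • (D + D.conjTranspose))

/-- The smallest positive eigenvalue. -/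
def minPosEig {d : ℕ} (F : Op d) : ℝ := sInf {x : ℝ | x ∈ spectrum ℝ F ∧ 0 < x}

/-- The effect on eigenvalues of the passage from `F̂` to `F̄`: positive eigenvalues are kept and
zero is replaced by the smallest positive eigenvalue divided by `N`. -/
def barFun {d : ℕ} (F : Op d) (N : ℕ) (x : ℝ) : ℝ := if 0 < x then x else minPosEig F / N

/-- The effect on eigenvalues of the passage from `F̂` to `F̃`. -/
def tildeFun {d : ℕ} (F : Op d) (N : ℕ) (x : ℝ) : ℝ := min (barFun F N x) 1

/-- `F̃^{1/2} F̄^{-1/2}`. -/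
def correction {d : ℕ} (F : Op d) (N : ℕ) : Op d :=
  cfc (fun x : ℝ => Real.sqrt (tildeFun F N x)) F * cfc (fun x : ℝ => (Real.sqrt (barFun F N x))⁻¹) F

/-- Step 4: with `Ĝ = ∑ vec(Ŝ_i) vec(Ŝ_i)†` and `F̂ = Tr₁ Ĝ`, the matrix
`∑ vec(Q̂_i) vec(Q̂_i)†` for `Q̂_i = F̃^{1/2} F̄^{-1/2} Ŝ_i`; it does not depend on the chosen
decomposition, since `vec(Q S) = (I ⊗ Q) vec(S)`. -/
def correctTrace {d : ℕ} (G : BiOp d) (N : ℕ) : BiOp d :=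
  Matrix.kronecker (1 : Op d) (correction (partialTrace₁ G) N) * G *
    (Matrix.kronecker (1 : Op d) (correction (partialTrace₁ G) N)).conjTranspose

namespace Config

variable {d M J : ℕ} {n : Fin J → ℕ} (S : Config d M J n)

/-- The two-stage estimate `X̂` from the record of the experiment. -/
def estX {N : ℕ} (ω : Record M J n N) : BiOp d :=
  correctTrace (projPSD (S.estD (freq ω))) N

/-- `𝔼 ‖X̂ - X‖`, the expectation over all measurement records with `N` copies per input. -/
def expectedError (T : Channel d) (X : BiOp d) (N : ℕ) : ℝ :=
  ∑ ω : Record M J n N, S.recordProb T ω * frobNorm (S.estX ω - X)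

end Config

end QPT

end

noncomputable section

open scoped ComplexOrder

namespace QPT

/-! ### The Frobenius norm -/

section FrobeniusNorm

open scoped Matrix.Norms.Frobenius

variable {l m n : Type} [Fintype l] [Fintype m] [Fintype n]

/-! The argument separates a deterministic perturbation bound from a second-moment computation.
Write `e = ‖D̂ - X‖`.

Deterministic part. Projecting onto the positive cone does not increase the distance to `X`, so `‖Ĝ
- X‖ ≤ e`. The partial trace costs a factor `√d`, and `F ≤ 1`, so the eigenvalues of `F̂` are at
most `1 + √d e`. The trace correction therefore multiplies by a matrix with spectrum in `[1 - √d e,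
1]` and moves `Ĝ` by at most `2 √d e ‖Ĝ‖`, where `‖Ĝ‖ ≤ Tr F + e`. Altogether the error is at most
`(2 √d Tr F + 1) e + 2 √d e²` (`frobNorm_correctTrace_projPSD_sub_le`).

Statistical part. Up to a reordering of columns `B` is `1 ⊗ Vᵀ`, so each entry of `D̂` is a linear
statistic of the frequencies whose coefficients are products of entries of the left inverses of `Vᵀ`
and `C` (`estD_apply`). At the exact probabilities it returns `X`. By independence `𝔼 e²` is at most
`1 / ⌊N/J⌋` times the product of the squared Frobenius norms of these inverses, which are the two
traces in the bound.

Jensen's inequality bounds `𝔼 e`. For large `N` the quadratic term is dominated by the linear one,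
and the summand not containing `Tr F` is absorbed through `√d Tr F ≥ δ`. For `X = 0` every
registered outcome has probability zero and the estimate is almost surely exact. The factor `√M`
enters only through `M ≥ 1`. -/

lemma frobNorm_eq_norm (A : Matrix m n ℂ) : frobNorm A = ‖A‖ := by
  rw [Matrix.frobenius_norm_def, frobNorm, Real.sqrt_eq_rpow]
  simp

lemma frobNorm_nonneg (A : Matrix m n ℂ) : 0 ≤ frobNorm A := Real.sqrt_nonneg _

lemma frobNorm_sq (A : Matrix m n ℂ) : frobNorm A ^ 2 = ∑ i, ∑ j, ‖A i j‖ ^ 2 :=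
  Real.sq_sqrt (by positivity)

lemma frobNorm_zero : frobNorm (0 : Matrix m n ℂ) = 0 := by
  simp [frobNorm]

lemma frobNorm_add_le (A B : Matrix m n ℂ) : frobNorm (A + B) ≤ frobNorm A + frobNorm B := by
  simpa only [frobNorm_eq_norm] using norm_add_le A B

lemma frobNorm_neg (A : Matrix m n ℂ) : frobNorm (-A) = frobNorm A := by
  simpa only [frobNorm_eq_norm] using norm_neg A

lemma frobNorm_conjTranspose (A : Matrix m n ℂ) : frobNorm A.conjTranspose = frobNorm A := by
  simpa only [frobNorm_eq_norm] using Matrix.frobenius_norm_conjTranspose A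

lemma frobNorm_mul_le (A : Matrix l m ℂ) (B : Matrix m n ℂ) :
    frobNorm (A * B) ≤ frobNorm A * frobNorm B := by
  simpa only [frobNorm_eq_norm] using Matrix.frobenius_norm_mul A B

lemma frobNorm_smul (c : ℂ) (A : Matrix m n ℂ) : frobNorm (c • A) = ‖c‖ * frobNorm A := by
  simpa only [frobNorm_eq_norm] using norm_smul c A

end FrobeniusNorm

/-! ### Trace and positivity inequalities -/

section Operators

variable {m n : Type} [Fintype m] [Fintype n]

lemma trace_conjTranspose_mul_self (A : Matrix m n ℂ) :
    (A.conjTranspose * A).trace = ((frobNorm A ^ 2 : ℝ) : ℂ) := by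
  rw [frobNorm_sq, Finset.sum_comm]
  simp [Matrix.trace, Matrix.mul_apply, Complex.conj_mul']

/-- Left multiplication by a matrix of operator norm at most `r`. -/
lemma frobNorm_mul_le_of_posSemidef [DecidableEq m] {A : Matrix m m ℂ} {r : ℝ} (hr : 0 ≤ r)
    (h : (((r ^ 2 : ℝ) : ℂ) • (1 : Matrix m m ℂ) - A.conjTranspose * A).PosSemidef)
    (B : Matrix m n ℂ) : frobNorm (A * B) ≤ r * frobNorm B := by
  have h1 := (h.conjTranspose_mul_mul_same B).trace_nonneg
  have h2 : B.conjTranspose * (((r ^ 2 : ℝ) : ℂ) • (1 : Matrix m m ℂ) - A.conjTranspose * A) * B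
      = ((r ^ 2 : ℝ) : ℂ) • (B.conjTranspose * B) - (A * B).conjTranspose * (A * B) := by
    simp [Matrix.mul_sub, Matrix.sub_mul, Matrix.mul_assoc]
  rw [h2, Matrix.trace_sub, Matrix.trace_smul, trace_conjTranspose_mul_self,
    trace_conjTranspose_mul_self, smul_eq_mul, ← Complex.ofReal_mul, ← Complex.ofReal_sub,
    Complex.zero_le_real] at h1
  refine abs_le_of_sq_le_sq' ?_ (mul_nonneg hr (frobNorm_nonneg B)) |>.2
  nlinarith

/-- With `B = K† K`, cyclicity turns the trace into that of `K A K†`. -/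
lemma trace_mul_posSemidef_nonneg {A B : Matrix n n ℂ} (hA : A.PosSemidef) (hB : B.PosSemidef) :
    0 ≤ (A * B).trace := by
  classical
  obtain ⟨K, rfl⟩ : ∃ K : Matrix n n ℂ, B = K.conjTranspose * K := by
    open scoped MatrixOrder in
    exact CStarAlgebra.nonneg_iff_eq_star_mul_self.mp hB.nonneg
  rw [← Matrix.mul_assoc, Matrix.trace_mul_comm, ← Matrix.mul_assoc]
  exact (hA.mul_mul_conjTranspose_same K).trace_nonneg

lemma frobNorm_le_trace {A : Matrix n n ℂ} (hA : A.PosSemidef) : frobNorm A ≤ A.trace.re := by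
  classical
  obtain ⟨K, rfl⟩ : ∃ K : Matrix n n ℂ, A = K.conjTranspose * K := by
    open scoped MatrixOrder in
    exact CStarAlgebra.nonneg_iff_eq_star_mul_self.mp hA.nonneg
  rw [trace_conjTranspose_mul_self, Complex.ofReal_re, sq]
  exact (frobNorm_mul_le _ _).trans_eq (by rw [frobNorm_conjTranspose])

/-- The Cauchy–Schwarz inequality for a quadratic form. -/
lemma posSemidef_frobNorm_smul_one_sub [DecidableEq n] {A : Matrix n n ℂ} (hA : A.IsHermitian) :
    (((frobNorm A : ℝ) : ℂ) • (1 : Matrix n n ℂ) - A).PosSemidef := by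
  refine .of_dotProduct_mulVec_nonneg ?_ fun x => ?_
  · refine Matrix.IsHermitian.sub ?_ hA
    simp [Matrix.IsHermitian, Matrix.conjTranspose_smul]
  -- Viewing the vector as a one-column matrix lets submultiplicativity of the Frobenius norm play
  -- the part of Cauchy–Schwarz.
  · set X : Matrix n Unit ℂ := Matrix.replicateCol Unit x with hX
    have e1 : star x ⬝ᵥ x = ((frobNorm X ^ 2 : ℝ) : ℂ) := by
      rw [← trace_conjTranspose_mul_self]
      simp [hX, Matrix.trace, Matrix.mul_apply, dotProduct]
    have e2 : star x ⬝ᵥ A.mulVec x = (X.conjTranspose * (A * X)) () () := by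
      simp [hX, Matrix.mul_apply, dotProduct, Matrix.mulVec]
    have e3 : ‖(X.conjTranspose * (A * X)) () ()‖ ≤ frobNorm A * frobNorm X ^ 2 := by
      have : ‖(X.conjTranspose * (A * X)) () ()‖ = frobNorm (X.conjTranspose * (A * X)) := by
        simp [frobNorm]
      rw [this]
      calc _ ≤ frobNorm X.conjTranspose * frobNorm (A * X) := frobNorm_mul_le _ _
        _ ≤ frobNorm X * (frobNorm A * frobNorm X) := by
          rw [frobNorm_conjTranspose]
          exact mul_le_mul_of_nonneg_left (frobNorm_mul_le _ _) (frobNorm_nonneg _)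
        _ = _ := by ring
    have e4 : star (star x ⬝ᵥ A.mulVec x) = star x ⬝ᵥ A.mulVec x := by
      conv_lhs => rw [Matrix.star_dotProduct, star_star, Matrix.star_mulVec, hA.eq,
        ← Matrix.dotProduct_mulVec]
    obtain ⟨t, ht⟩ := Complex.conj_eq_iff_real.mp e4
    rw [Matrix.sub_mulVec, dotProduct_sub, Matrix.smul_mulVec, Matrix.one_mulVec, dotProduct_smul,
      smul_eq_mul, e1, ht, ← Complex.ofReal_mul, ← Complex.ofReal_sub, Complex.zero_le_real]
    rw [← e2, ht, Complex.norm_real] at e3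
    linarith [Real.le_norm_self t]

end Operators

/-! ### Functional calculus of Hermitian matrices -/

section FunctionalCalculus

open scoped MatrixOrder

variable {n : Type} [Fintype n] [DecidableEq n] {A : Matrix n n ℂ}

/-- The spectrum is finite, so `cfc` is meaningful even for functions that jump at `0`, such as
`barFun`. -/
lemma continuousOn_spectrum (A : Matrix n n ℂ) (f : ℝ → ℝ) : ContinuousOn f (spectrum ℝ A) :=
  A.finite_real_spectrum.continuousOn f

lemma cfc_isHermitian (f : ℝ → ℝ) (A : Matrix n n ℂ) : (cfc f A).IsHermitian :=
  cfc_predicate f A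

lemma cfc_posSemidef {f : ℝ → ℝ} (h : ∀ x ∈ spectrum ℝ A, 0 ≤ f x) : (cfc f A).PosSemidef :=
  Matrix.nonneg_iff_posSemidef.mp (cfc_nonneg h)

lemma cfc_mul_cfc (f g : ℝ → ℝ) (A : Matrix n n ℂ) :
    cfc f A * cfc g A = cfc (fun x => f x * g x) A :=
  (cfc_mul f g A (continuousOn_spectrum A f) (continuousOn_spectrum A g)).symm

lemma cfc_sub_cfc (f g : ℝ → ℝ) (A : Matrix n n ℂ) :
    cfc f A - cfc g A = cfc (fun x => f x - g x) A :=
  (cfc_sub f g A (continuousOn_spectrum A f) (continuousOn_spectrum A g)).symm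

lemma spectrum_le_of_posSemidef_sub (hA : A.IsHermitian) {c : ℝ}
    (h : ((c : ℂ) • (1 : Matrix n n ℂ) - A).PosSemidef) : ∀ x ∈ spectrum ℝ A, x ≤ c := by
  have hc : algebraMap ℝ (Matrix n n ℂ) c = (c : ℂ) • 1 := by
    rw [Algebra.algebraMap_eq_smul_one, Complex.coe_smul]
  exact (le_algebraMap_iff_spectrum_le (R := ℝ) (ha := hA.isSelfAdjoint)).mp
    (by rw [hc]; exact Matrix.le_iff.mpr h)

lemma spectrum_nonneg (hA : A.PosSemidef) : ∀ x ∈ spectrum ℝ A, 0 ≤ x :=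
  fun _ hx => _root_.spectrum_nonneg_of_nonneg hA.nonneg hx

/-- The operator norm of a matrix function is bounded by the function. -/
lemma posSemidef_sq_smul_one_sub_cfc (hA : A.IsHermitian) {f : ℝ → ℝ} {r : ℝ}
    (h : ∀ x ∈ spectrum ℝ A, 0 ≤ f x ∧ f x ≤ r) :
    (((r ^ 2 : ℝ) : ℂ) • (1 : Matrix n n ℂ) - (cfc f A).conjTranspose * cfc f A).PosSemidef := by
  have hc : (((r ^ 2 : ℝ) : ℂ) • (1 : Matrix n n ℂ)) = cfc (fun _ : ℝ => r ^ 2) A := by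
    rw [cfc_const (r ^ 2) A hA.isSelfAdjoint, Algebra.algebraMap_eq_smul_one, Complex.coe_smul]
  rw [(cfc_isHermitian f A).eq, cfc_mul_cfc, hc, cfc_sub_cfc]
  refine cfc_posSemidef fun x hx => ?_
  nlinarith [h x hx]

end FunctionalCalculus

/-! ### Sums of independent centred random vectors on finite product spaces -/

section ProductWeights

variable {ι : Type} [Fintype ι] [DecidableEq ι] {α : ι → Type} [∀ i, Fintype (α i)]

/-- A probability weight on a finite type. -/
structure IsWeight {β : Type} [Fintype β] (w : β → ℝ) : Prop where
  nonneg : ∀ b, 0 ≤ w b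
  sum_eq_one : ∑ b, w b = 1

lemma IsWeight.pi {w : ∀ i, α i → ℝ} (hw : ∀ i, IsWeight (w i)) :
    IsWeight fun ω : ∀ i, α i => ∏ i, w i (ω i) := by
  refine ⟨fun ω => Finset.prod_nonneg fun i _ => (hw i).nonneg _, ?_⟩
  rw [← Fintype.prod_sum]
  simp [(hw _).sum_eq_one]

lemma sum_pi_weight_mul {w : ∀ i, α i → ℝ} (hw : ∀ i, IsWeight (w i)) (i : ι) (f : α i → ℂ) :
    ∑ ω : ∀ i, α i, ((∏ j, w j (ω j) : ℝ) : ℂ) * f (ω i) = ∑ a, (w i a : ℂ) * f a := by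
  -- Extending `f` by the factor `1` at all other coordinates makes the summand a product over
  -- coordinates, so the sum factorises.
  have h1 : ∀ ω : ∀ i, α i, ((∏ j, w j (ω j) : ℝ) : ℂ) * f (ω i) =
      ∏ j, ((w j (ω j) : ℂ) * (if h : j = i then f (h ▸ ω j) else 1)) := by
    intro ω
    rw [Finset.prod_mul_distrib, Complex.ofReal_prod]
    congr 1
    rw [Finset.prod_eq_single i (by intro b _ hb; simp [hb]) (by simp)]
    simp
  simp_rw [h1]
  rw [← Fintype.prod_sum (f := fun j a => (w j a : ℂ) * (if h : j = i then f (h ▸ a) else 1)),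
    Finset.prod_eq_single i]
  · simp
  · intro b _ hb
    simp only [hb, dite_false, mul_one]
    exact_mod_cast (hw b).sum_eq_one
  · simp

lemma sum_pi_weight_mul_mul {w : ∀ i, α i → ℝ} (hw : ∀ i, IsWeight (w i)) {i k : ι} (hik : i ≠ k)
    (f : α i → ℂ) (g : α k → ℂ) :
    ∑ ω : ∀ i, α i, ((∏ j, w j (ω j) : ℝ) : ℂ) * (f (ω i) * g (ω k)) =
      (∑ a, (w i a : ℂ) * f a) * ∑ a, (w k a : ℂ) * g a := by
  have h1 : ∀ ω : ∀ i, α i, ((∏ j, w j (ω j) : ℝ) : ℂ) * (f (ω i) * g (ω k)) =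
      ∏ j, ((w j (ω j) : ℂ) * ((if h : j = i then f (h ▸ ω j) else 1) *
        (if h : j = k then g (h ▸ ω j) else 1))) := by
    intro ω
    rw [Finset.prod_mul_distrib, Complex.ofReal_prod, Finset.prod_mul_distrib]
    congr 2
    · rw [Finset.prod_eq_single i (by intro b _ hb; simp [hb]) (by simp)]
      simp
    · rw [Finset.prod_eq_single k (by intro b _ hb; simp [hb]) (by simp)]
      simp
  simp_rw [h1]
  rw [← Fintype.prod_sum (f := fun j a => (w j a : ℂ) * ((if h : j = i then f (h ▸ a) else 1) *
        (if h : j = k then g (h ▸ a) else 1))), Finset.prod_eq_mul i k hik]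
  · simp [hik, hik.symm]
  · intro b _ hb
    simp only [hb.1, hb.2, dite_false, mul_one]
    exact_mod_cast (hw b).sum_eq_one
  · simp
  · simp

/-- The mean of a sum of centred independent variables vanishes. -/
lemma sum_pi_weight_sum_eq_zero {w : ∀ i, α i → ℝ} (hw : ∀ i, IsWeight (w i)) {f : ∀ i, α i → ℂ}
    (hf : ∀ i, ∑ a, (w i a : ℂ) * f i a = 0) :
    ∑ ω : ∀ i, α i, ((∏ j, w j (ω j) : ℝ) : ℂ) * ∑ i, f i (ω i) = 0 := by
  simp_rw [Finset.mul_sum]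
  rw [Finset.sum_comm]
  exact Finset.sum_eq_zero fun i _ => (sum_pi_weight_mul hw i (f i)).trans (hf i)

/-- The variance of a sum of centred independent variables. -/
lemma sum_pi_weight_sq_norm_sum {w : ∀ i, α i → ℝ} (hw : ∀ i, IsWeight (w i)) {f : ∀ i, α i → ℂ}
    (hf : ∀ i, ∑ a, (w i a : ℂ) * f i a = 0) :
    ∑ ω : ∀ i, α i, (∏ j, w j (ω j)) * ‖∑ i, f i (ω i)‖ ^ 2 =
      ∑ i, ∑ a, w i a * ‖f i a‖ ^ 2 := by
  apply Complex.ofReal_injective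
  -- After expanding the square, off-diagonal terms factor into means and vanish.
  have h1 : ∀ ω : ∀ i, α i, (((∏ j, w j (ω j)) * ‖∑ i, f i (ω i)‖ ^ 2 : ℝ) : ℂ) =
      ∑ i, ∑ k, ((∏ j, w j (ω j) : ℝ) : ℂ) * (f i (ω i) * star (f k (ω k))) := by
    intro ω
    push_cast
    rw [← Complex.mul_conj', map_sum, Finset.sum_mul_sum, Finset.mul_sum]
    simp_rw [Finset.mul_sum]
    rfl
  rw [Complex.ofReal_sum]
  simp_rw [h1]
  rw [Finset.sum_comm, Complex.ofReal_sum]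
  refine Finset.sum_congr rfl fun i _ => ?_
  rw [Finset.sum_comm, Finset.sum_eq_single i]
  · rw [sum_pi_weight_mul hw i (fun a => f i a * star (f i a))]
    push_cast
    refine Finset.sum_congr rfl fun a _ => ?_
    rw [← Complex.mul_conj']
    rfl
  · intro k _ hk
    rw [sum_pi_weight_mul_mul hw hk.symm (f i) (fun a => star (f k a)), hf i, zero_mul]
  · simp

/-- The variance is at most the second moment. -/
lemma sum_weight_mul_sq_norm_sub_mean_le {β : Type} [Fintype β] {w : β → ℝ} (hw : IsWeight w)
    (f : β → ℂ) :
    ∑ b, w b * ‖f b - ∑ a, (w a : ℂ) * f a‖ ^ 2 ≤ ∑ b, w b * ‖f b‖ ^ 2 := by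
  set μ := ∑ a, (w a : ℂ) * f a with hμ
  have key : ∑ b, w b * ‖f b - μ‖ ^ 2 = ∑ b, w b * ‖f b‖ ^ 2 - ‖μ‖ ^ 2 := by
    apply Complex.ofReal_injective
    push_cast
    simp_rw [← Complex.mul_conj', map_sub]
    have e1 : ∀ b, (w b : ℂ) * ((f b - μ) * ((starRingEnd ℂ) (f b) - (starRingEnd ℂ) μ)) =
        (w b : ℂ) * (f b * (starRingEnd ℂ) (f b)) - ((w b : ℂ) * f b) * (starRingEnd ℂ) μ
          - μ * ((w b : ℂ) * (starRingEnd ℂ) (f b)) + (w b : ℂ) * (μ * (starRingEnd ℂ) μ) := by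
      intro b; ring
    have e2 : ∑ b, (w b : ℂ) * (starRingEnd ℂ) (f b) = (starRingEnd ℂ) μ := by
      simp [hμ, map_sum]
    have e3 : ∑ b, (w b : ℂ) = 1 := by exact_mod_cast hw.sum_eq_one
    simp_rw [e1]
    rw [Finset.sum_add_distrib, Finset.sum_sub_distrib, Finset.sum_sub_distrib, ← Finset.sum_mul,
      ← Finset.mul_sum, ← Finset.sum_mul, e2, e3, ← hμ]
    ring
  rw [key]
  linarith [sq_nonneg ‖μ‖]

/-- Jensen's inequality for the square. -/
lemma sum_weight_mul_le_sqrt {β : Type} [Fintype β] {w : β → ℝ} (hw : IsWeight w) (f : β → ℝ) :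
    ∑ b, w b * f b ≤ Real.sqrt (∑ b, w b * f b ^ 2) := by
  apply Real.le_sqrt_of_sq_le
  have h := Finset.sum_mul_sq_le_sq_mul_sq Finset.univ (fun b => Real.sqrt (w b))
    (fun b => Real.sqrt (w b) * f b)
  simp_rw [mul_pow, Real.sq_sqrt (hw.nonneg _), ← mul_assoc,
    Real.mul_self_sqrt (hw.nonneg _), hw.sum_eq_one, one_mul] at h
  exact h

end ProductWeights

variable {d : ℕ}

/-! ### The partial trace -/

section PartialTrace

lemma partialTrace₁_sub (X Y : BiOp d) :
    partialTrace₁ (X - Y) = partialTrace₁ X - partialTrace₁ Y := by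
  ext a b
  simp [partialTrace₁]

lemma trace_partialTrace₁ (X : BiOp d) : (partialTrace₁ X).trace = X.trace := by
  simp only [partialTrace₁, Matrix.trace, Matrix.diag_apply, Matrix.of_apply, Fintype.sum_prod_type]
  exact Finset.sum_comm

lemma partialTrace₁_posSemidef {X : BiOp d} (hX : X.PosSemidef) :
    (partialTrace₁ X).PosSemidef := by
  have : partialTrace₁ X = ∑ k, X.submatrix (fun a => (k, a)) (fun a => (k, a)) := by
    ext a b
    simp [partialTrace₁, Matrix.sum_apply]
  rw [this]
  exact Matrix.posSemidef_sum _ fun k _ => hX.submatrix _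

/-- Cauchy–Schwarz over the `d` summands of each entry gives the `√d`; only the diagonal blocks of
`X` are used. -/
lemma frobNorm_partialTrace₁_le (X : BiOp d) :
    frobNorm (partialTrace₁ X) ≤ Real.sqrt d * frobNorm X := by
  rw [frobNorm, frobNorm, ← Real.sqrt_mul (Nat.cast_nonneg d)]
  apply Real.sqrt_le_sqrt
  have h1 : ∀ a b, ‖partialTrace₁ X a b‖ ^ 2 ≤ d * ∑ k, ‖X (k, a) (k, b)‖ ^ 2 := by
    intro a b
    calc ‖partialTrace₁ X a b‖ ^ 2 ≤ (∑ k, ‖X (k, a) (k, b)‖) ^ 2 := by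
          gcongr
          exact norm_sum_le Finset.univ fun k => X (k, a) (k, b)
      _ ≤ _ := by simpa using sq_sum_le_card_mul_sum_sq (s := (Finset.univ : Finset (Fin d)))
                    (f := fun k => ‖X (k, a) (k, b)‖)
  calc ∑ a, ∑ b, ‖partialTrace₁ X a b‖ ^ 2
      ≤ ∑ a, ∑ b, d * ∑ k, ‖X (k, a) (k, b)‖ ^ 2 := by
        gcongr with a _ b _
        exact h1 a b
    _ = d * ∑ k, ∑ a, ∑ b, ‖X (k, a) (k, b)‖ ^ 2 := by
        simp_rw [← Finset.mul_sum]
        congr 1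
        rw [Finset.sum_comm (γ := Fin d)]
        rw [Finset.sum_comm]
        simp_rw [Finset.sum_comm (f := fun (b k : Fin d) => ‖X (k, _) (k, b)‖ ^ 2)]
        rw [Finset.sum_comm]
    _ ≤ d * ∑ i, ∑ j, ‖X i j‖ ^ 2 := by
        simp_rw [Fintype.sum_prod_type]
        refine mul_le_mul_of_nonneg_left ?_ (Nat.cast_nonneg d)
        refine Finset.sum_le_sum fun k _ => Finset.sum_le_sum fun a _ => ?_
        exact Finset.single_le_sum (f := fun k' => ∑ b, ‖X (k, a) (k', b)‖ ^ 2)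
          (fun _ _ => by positivity) (Finset.mem_univ k)

end PartialTrace

/-! ### The projection onto the positive semidefinite matrices -/

section Projection

lemma projPSD_posSemidef (D : BiOp d) : (projPSD D).PosSemidef :=
  cfc_posSemidef fun _ _ => le_max_right _ _

/-- The Hermitian part `H` splits as `G - K` with `G, K ≥ 0` and `G K = 0`. Hence `‖H - X‖² = ‖G -
X‖² + ‖K‖² + 2 Tr (X K)`, and the last two terms are nonnegative. Passing from `D` to `H` is
harmless because `X` is Hermitian. -/
lemma frobNorm_projPSD_sub_le (D : BiOp d) {X : BiOp d} (hX : X.PosSemidef) :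
    frobNorm (projPSD D - X) ≤ frobNorm (D - X) := by
  set H : BiOp d := (1 / 2 : ℂ) • (D + D.conjTranspose) with hH
  have hHh : H.IsHermitian := by
    simp [hH, Matrix.IsHermitian, Matrix.conjTranspose_smul, add_comm]
  set K : BiOp d := cfc (fun x : ℝ => max x 0 - x) H with hK
  have hG : projPSD D = cfc (fun x : ℝ => max x 0) H := rfl
  have hKp : K.PosSemidef := cfc_posSemidef fun x _ => sub_nonneg.mpr (le_max_left _ _)
  have hGp := projPSD_posSemidef D
  have hGK : projPSD D * K = 0 := by
    rw [hG, hK, cfc_mul_cfc]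
    have : (fun x : ℝ => max x 0 * (max x 0 - x)) = fun _ => 0 := by
      ext x
      rcases le_total x 0 with h | h <;> simp [h]
    rw [this, cfc_const_zero]
  have hKG : K * projPSD D = 0 := by
    have := congrArg Matrix.conjTranspose hGK
    rwa [Matrix.conjTranspose_mul, hGp.1.eq, hKp.1.eq, Matrix.conjTranspose_zero] at this
  have hHe : H = projPSD D - K := by
    rw [hG, hK, cfc_sub_cfc]
    simp only [sub_sub_cancel]
    exact (cfc_id' ℝ H hHh.isSelfAdjoint).symm
  have e1 : frobNorm (H - X) ≤ frobNorm (D - X) := by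
    have : H - X = (1 / 2 : ℂ) • ((D - X) + (D - X).conjTranspose) := by
      rw [Matrix.conjTranspose_sub, hX.1.eq, hH]
      module
    rw [this, frobNorm_smul]
    have := frobNorm_add_le (D - X) (D - X).conjTranspose
    rw [frobNorm_conjTranspose] at this
    rw [show ‖(1 / 2 : ℂ)‖ = 1 / 2 by norm_num]
    linarith
  refine le_trans ?_ e1
  refine abs_le_of_sq_le_sq' ?_ (frobNorm_nonneg _) |>.2
  have e2 : (H - X).conjTranspose * (H - X) =
      (projPSD D - X).conjTranspose * (projPSD D - X) + K.conjTranspose * K + X * K + K * X := by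
    have : H - X = (projPSD D - X) - K := by rw [hHe]; abel
    rw [this]
    simp only [Matrix.conjTranspose_sub, hX.1.eq, hGp.1.eq, hKp.1.eq, Matrix.sub_mul,
      Matrix.mul_sub, hGK, hKG]
    abel
  have e3 := congrArg Matrix.trace e2
  rw [Matrix.trace_add, Matrix.trace_add, Matrix.trace_add, trace_conjTranspose_mul_self,
    trace_conjTranspose_mul_self, trace_conjTranspose_mul_self, Matrix.trace_mul_comm K X] at e3
  have e4 := (Complex.nonneg_iff.mp (trace_mul_posSemidef_nonneg hX hKp)).1
  have e5 := congrArg Complex.re e3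
  simp only [Complex.add_re, Complex.ofReal_re] at e5
  nlinarith [sq_nonneg (frobNorm K)]

end Projection

/-! ### The trace correction -/

section Correction

lemma one_kronecker_sub (A B : Op d) : Matrix.kronecker (1 : Op d) (A - B) =
    Matrix.kronecker (1 : Op d) A - Matrix.kronecker (1 : Op d) B := by
  ext i j
  simp [Matrix.kronecker, mul_sub]

lemma one_kronecker_smul_one (c : ℂ) :
    Matrix.kronecker (1 : Op d) (c • (1 : Op d)) = c • (1 : BiOp d) :=
  (Matrix.kronecker_smul c (1 : Op d) (1 : Op d)).trans
    (congrArg (c • ·) (Matrix.one_kronecker_one (m := Fin d) (n := Fin d) (α := ℂ)))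

lemma conjTranspose_one_kronecker_mul_self (A : Op d) :
    (Matrix.kronecker (1 : Op d) A).conjTranspose * Matrix.kronecker (1 : Op d) A =
      Matrix.kronecker (1 : Op d) (A.conjTranspose * A) := by
  have h := Matrix.mul_kronecker_mul (1 : Op d) (1 : Op d) A.conjTranspose A
  rw [mul_one] at h
  have h' := Matrix.conjTranspose_kronecker (1 : Op d) A
  rw [Matrix.conjTranspose_one] at h'
  exact (congrArg (· * Matrix.kronecker (1 : Op d) A) h').trans h.symm

lemma frobNorm_one_kronecker_mul_le {A : Op d} {r : ℝ} (hr : 0 ≤ r)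
    (h : (((r ^ 2 : ℝ) : ℂ) • (1 : Op d) - A.conjTranspose * A).PosSemidef) (G : BiOp d) :
    frobNorm (Matrix.kronecker (1 : Op d) A * G) ≤ r * frobNorm G := by
  refine frobNorm_mul_le_of_posSemidef hr ?_ G
  have : (((r ^ 2 : ℝ) : ℂ) • (1 : BiOp d) -
      (Matrix.kronecker (1 : Op d) A).conjTranspose * Matrix.kronecker (1 : Op d) A) =
      Matrix.kronecker (1 : Op d) (((r ^ 2 : ℝ) : ℂ) • (1 : Op d) - A.conjTranspose * A) := by
    rw [one_kronecker_sub, one_kronecker_smul_one, conjTranspose_one_kronecker_mul_self]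
  rw [this]
  exact Matrix.PosSemidef.one.kronecker h

lemma exists_pos_mem_spectrum {F : Op d} (hF : F.PosSemidef) (h0 : F ≠ 0) :
    ∃ x ∈ spectrum ℝ F, 0 < x := by
  by_contra! hcon
  refine h0 ?_
  rw [← cfc_id' ℝ F hF.1.isSelfAdjoint, ← cfc_const_zero ℝ F]
  exact cfc_congr fun x hx => le_antisymm (hcon x hx) (spectrum_nonneg hF x hx)

lemma minPosEig_mem {F : Op d} (hF : F.PosSemidef) (h0 : F ≠ 0) :
    minPosEig F ∈ spectrum ℝ F ∧ 0 < minPosEig F := by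
  obtain ⟨x, hx, hx0⟩ := exists_pos_mem_spectrum hF h0
  exact Set.Nonempty.csInf_mem (s := {x : ℝ | x ∈ spectrum ℝ F ∧ 0 < x}) ⟨x, hx, hx0⟩
    (F.finite_real_spectrum.subset fun _ h => h.1)

/-- The eigenvalues of `F̃^{1/2} F̄^{-1/2}`. -/
def correctionFun (F : Op d) (N : ℕ) (x : ℝ) : ℝ :=
  Real.sqrt (tildeFun F N x) * (Real.sqrt (barFun F N x))⁻¹

lemma correction_eq_cfc (F : Op d) (N : ℕ) : correction F N = cfc (correctionFun F N) F :=
  cfc_mul_cfc _ _ _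

/-- The factor is `1` for `b ≤ 1`. Otherwise it is `1 / √b`, and `1 - 1 / √b ≤ √b - 1 ≤ b - 1 ≤ η`.
-/
lemma sqrt_min_one_mul_inv_sqrt_mem {b η : ℝ} (hb : 0 < b) (hη : 0 ≤ η) (h : b ≤ 1 + η) :
    0 ≤ Real.sqrt (min b 1) * (Real.sqrt b)⁻¹ ∧ Real.sqrt (min b 1) * (Real.sqrt b)⁻¹ ≤ 1 ∧
      1 - Real.sqrt (min b 1) * (Real.sqrt b)⁻¹ ≤ η := by
  have hs : 0 < Real.sqrt b := Real.sqrt_pos.mpr hb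
  refine ⟨by positivity, ?_, ?_⟩
  · rw [mul_inv_le_iff₀ hs, one_mul]
    exact Real.sqrt_le_sqrt (min_le_left _ _)
  · rcases le_total b 1 with h1 | h1
    · rw [min_eq_left h1, mul_inv_cancel₀ hs.ne']
      linarith
    · rw [min_eq_right h1, Real.sqrt_one, one_mul]
      have h2 : 1 ≤ Real.sqrt b := Real.one_le_sqrt.mpr h1
      have h3 := Real.sq_sqrt hb.le
      have h4 : 1 - (Real.sqrt b)⁻¹ ≤ Real.sqrt b - 1 := by
        have : Real.sqrt b * (Real.sqrt b)⁻¹ = 1 := mul_inv_cancel₀ hs.ne'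
        have h5 : 0 < (Real.sqrt b)⁻¹ := by positivity
        nlinarith
      nlinarith

/-- The value replacing a zero eigenvalue is positive because `F ≠ 0`. As `N ≥ 1`, it is at most the
smallest positive eigenvalue, so it obeys the same upper bound as the spectrum. -/
lemma correctionFun_mem {F : Op d} (hF : F.PosSemidef) (h0 : F ≠ 0) {N : ℕ} (hN : 1 ≤ N) {η : ℝ}
    (hη : 0 ≤ η) (h : ∀ x ∈ spectrum ℝ F, x ≤ 1 + η) {x : ℝ} (hx : x ∈ spectrum ℝ F) :
    0 ≤ correctionFun F N x ∧ correctionFun F N x ≤ 1 ∧ 1 - correctionFun F N x ≤ η := by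
  have hN' : (1 : ℝ) ≤ N := by exact_mod_cast hN
  obtain ⟨hm, hm0⟩ := minPosEig_mem hF h0
  refine sqrt_min_one_mul_inv_sqrt_mem ?_ hη ?_
  · unfold barFun
    split_ifs with hx0
    · exact hx0
    · positivity
  · unfold barFun
    split_ifs with hx0
    · exact h x hx
    · exact (div_le_self hm0.le hN').trans (h _ hm)

/-- The trace correction moves `G` only as far as its partial trace exceeds the identity. -/
lemma frobNorm_correctTrace_sub_le {G : BiOp d} (hG : G.PosSemidef) {N : ℕ} (hN : 1 ≤ N) {η : ℝ}
    (hη : 0 ≤ η) (h : ∀ x ∈ spectrum ℝ (partialTrace₁ G), x ≤ 1 + η) :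
    frobNorm (correctTrace G N - G) ≤ 2 * η * frobNorm G := by
  by_cases h0 : partialTrace₁ G = 0
  · have : G = 0 := hG.trace_eq_zero_iff.mp (by rw [← trace_partialTrace₁, h0, Matrix.trace_zero])
    subst this
    simp [correctTrace, frobNorm_zero]
  have hF := partialTrace₁_posSemidef hG
  set F := partialTrace₁ G with hFdef
  set R : Op d := cfc (fun x => 1 - correctionFun F N x) F with hR
  set Q : Op d := correction F N with hQ
  have hQR : Q = 1 - R := by
    have h1 : (1 : Op d) = cfc (fun _ : ℝ => (1 : ℝ)) F :=
      (cfc_const_one ℝ F hF.1.isSelfAdjoint).symm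
    rw [hR, h1, cfc_sub_cfc, hQ, correction_eq_cfc]
    simp
  have hRn := posSemidef_sq_smul_one_sub_cfc (r := η) hF.1 (f := fun x => 1 - correctionFun F N x)
    fun x hx => ⟨sub_nonneg.mpr (correctionFun_mem hF h0 hN hη h hx).2.1,
      (correctionFun_mem hF h0 hN hη h hx).2.2⟩
  have hQn := posSemidef_sq_smul_one_sub_cfc (r := 1) hF.1 (f := correctionFun F N)
    fun x hx => ⟨(correctionFun_mem hF h0 hN hη h hx).1, (correctionFun_mem hF h0 hN hη h hx).2.1⟩
  rw [← correction_eq_cfc, ← hQ] at hQn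
  rw [← hR] at hRn
  set Q' : BiOp d := Matrix.kronecker (1 : Op d) Q with hQ'
  set R' : BiOp d := Matrix.kronecker (1 : Op d) R with hR'
  have hQR' : Q' = 1 - R' := by
    have h1 := one_kronecker_smul_one (d := d) 1
    rw [one_smul, one_smul] at h1
    rw [hQ', hR', hQR, one_kronecker_sub, h1]
  -- With `Q' = 1 - R'`, only terms containing the small factor `R'` survive; `Q'` is a contraction.
  have e1 : correctTrace G N - G = -(R' * (Q' * G).conjTranspose + (R' * G).conjTranspose) := by
    have : correctTrace G N = Q' * G * Q'.conjTranspose := rfl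
    rw [this, Matrix.conjTranspose_mul, Matrix.conjTranspose_mul, hG.1.eq, hQR']
    simp only [Matrix.conjTranspose_sub, Matrix.sub_mul, Matrix.mul_sub, Matrix.conjTranspose_one,
      Matrix.mul_one, Matrix.one_mul, ← Matrix.mul_assoc]
    abel
  rw [e1, frobNorm_neg]
  calc _ ≤ frobNorm (R' * (Q' * G).conjTranspose) + frobNorm (R' * G).conjTranspose :=
        frobNorm_add_le _ _
    _ ≤ η * frobNorm G + η * frobNorm G := by
        gcongr
        · refine (frobNorm_one_kronecker_mul_le hη hRn _).trans ?_
          gcongr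
          rw [frobNorm_conjTranspose]
          exact (frobNorm_one_kronecker_mul_le zero_le_one hQn G).trans_eq (one_mul _)
        · rw [frobNorm_conjTranspose]
          exact frobNorm_one_kronecker_mul_le hη hRn G
    _ = _ := by ring

/-- The deterministic part of the error analysis: the error of the two-stage estimate in terms of
the error of the linear inversion. -/
lemma frobNorm_correctTrace_projPSD_sub_le {X : BiOp d} (hX : X.PosSemidef)
    (hF : (1 - partialTrace₁ X).PosSemidef) (D : BiOp d) {N : ℕ} (hN : 1 ≤ N) :
    frobNorm (correctTrace (projPSD D) N - X) ≤
      (2 * (Real.sqrt d * (partialTrace₁ X).trace.re) + 1) * frobNorm (D - X) +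
        2 * Real.sqrt d * frobNorm (D - X) ^ 2 := by
  set e := frobNorm (D - X) with he
  have he0 : 0 ≤ e := frobNorm_nonneg _
  set G := projPSD D with hGdef
  have hG : G.PosSemidef := projPSD_posSemidef D
  have h1 : frobNorm (G - X) ≤ e := frobNorm_projPSD_sub_le D hX
  have h2 : frobNorm (partialTrace₁ G - partialTrace₁ X) ≤ Real.sqrt d * e := by
    rw [← partialTrace₁_sub]
    exact (frobNorm_partialTrace₁_le _).trans (by gcongr)
  have hGF := partialTrace₁_posSemidef hG
  have hXF := partialTrace₁_posSemidef hX
  have h3 : ∀ x ∈ spectrum ℝ (partialTrace₁ G), x ≤ 1 + Real.sqrt d * e := by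
    intro x hx
    refine le_trans (spectrum_le_of_posSemidef_sub (c := 1 + frobNorm (partialTrace₁ G -
      partialTrace₁ X)) hGF.1 ?_ x hx) (by gcongr)
    -- With `Δ = Tr₁ G - Tr₁ X`, the sum of `‖Δ‖ 1 - Δ ≥ 0` and `1 - Tr₁ X ≥ 0` is `(1 + ‖Δ‖) 1 -
    -- Tr₁ G`.
    have := (posSemidef_frobNorm_smul_one_sub (hGF.1.sub hXF.1)).add hF
    convert! this using 1
    push_cast
    module
  have h4 := frobNorm_correctTrace_sub_le hG hN (by positivity) h3
  have h5 : frobNorm G ≤ (partialTrace₁ X).trace.re + e := by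
    have := frobNorm_add_le (G - X) X
    rw [sub_add_cancel] at this
    rw [trace_partialTrace₁]
    linarith [frobNorm_le_trace hX]
  have h6 := frobNorm_add_le (correctTrace G N - G) (G - X)
  rw [sub_add_sub_cancel] at h6
  have h7 : 2 * (Real.sqrt d * e) * frobNorm G ≤
      2 * (Real.sqrt d * e) * ((partialTrace₁ X).trace.re + e) := by gcongr
  nlinarith

end Correction

/-! ### Least squares inversion -/

section PseudoInverse

variable {m n : Type} [Fintype m] [Fintype n] [DecidableEq n]

/-- The left inverse `(A† A)⁻¹ A†` of a matrix of full column rank. -/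
def leastSquares (A : Matrix m n ℂ) : Matrix n m ℂ :=
  (A.conjTranspose * A)⁻¹ * A.conjTranspose

variable {A : Matrix m n ℂ}

lemma isUnit_det_conjTranspose_mul_self (hA : ∀ x, A.mulVec x = 0 → x = 0) :
    IsUnit (A.conjTranspose * A).det := by
  have : Function.Injective A.mulVec := fun x y hxy => sub_eq_zero.mp <| hA _ <| by
    rw [Matrix.mulVec_sub, sub_eq_zero]
    exact hxy
  exact (Matrix.isUnit_iff_isUnit_det _).mp
    (Matrix.PosDef.conjTranspose_mul_self A this).isUnit

lemma leastSquares_mul_self (hA : ∀ x, A.mulVec x = 0 → x = 0) : leastSquares A * A = 1 := by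
  rw [leastSquares, Matrix.mul_assoc,
    Matrix.nonsing_inv_mul _ (isUnit_det_conjTranspose_mul_self hA)]

/-- For `L = (A† A)⁻¹ A†` one has `L L† = (A† A)⁻¹`. This is the source of both traces in the error
bound. -/
lemma frobNorm_leastSquares_sq (hA : ∀ x, A.mulVec x = 0 → x = 0) :
    frobNorm (leastSquares A) ^ 2 = (A.conjTranspose * A)⁻¹.trace.re := by
  rw [← frobNorm_conjTranspose, ← Complex.ofReal_re (frobNorm _ ^ 2),
    ← trace_conjTranspose_mul_self, Matrix.conjTranspose_conjTranspose]
  congr 2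
  have h : (leastSquares A).conjTranspose = A * (A.conjTranspose * A)⁻¹ := by
    rw [leastSquares, Matrix.conjTranspose_mul, Matrix.conjTranspose_conjTranspose,
      Matrix.conjTranspose_nonsing_inv, Matrix.conjTranspose_mul,
      Matrix.conjTranspose_conjTranspose]
  rw [h, ← Matrix.mul_assoc, leastSquares_mul_self hA, Matrix.one_mul]

end PseudoInverse

/-! ### Informational completeness and the linear inversion in coordinates -/

/-- A linear functional vanishing on a spanning family is zero; matrix units then read off its
coefficients. -/
lemma eq_zero_of_span_eq_top {d : ℕ} {κ : Type} {Q : κ → Op d}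
    (hQ : Submodule.span ℂ (Set.range Q) = ⊤) (y : Fin d × Fin d → ℂ)
    (h : ∀ l, ∑ a, y a * Q l a.1 a.2 = 0) : y = 0 := by
  let φ : Op d →ₗ[ℂ] ℂ :=
    { toFun := fun A => ∑ a, y a * A a.1 a.2
      map_add' := fun A B => by simp [mul_add, Finset.sum_add_distrib]
      map_smul' := fun c A => by
        simp only [Matrix.smul_apply, smul_eq_mul, RingHom.id_apply, Finset.mul_sum]
        exact Finset.sum_congr rfl fun _ _ => by ring }
  have hφ : φ = 0 := LinearMap.ext_on_range hQ fun l => h l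
  ext a
  have := LinearMap.congr_fun hφ (Matrix.single a.1 a.2 1)
  simp only [φ, LinearMap.coe_mk, AddHom.coe_mk, LinearMap.zero_apply] at this
  rw [Finset.sum_eq_single a] at this
  · simpa using this
  · intro b _ hb
    have : ¬ (a.1 = b.1 ∧ a.2 = b.2) := fun hab => hb (Prod.ext hab.1.symm hab.2.symm)
    simp [this]
  · simp

namespace Config

variable {d M J : ℕ} {n : Fin J → ℕ} (S : Config d M J n)

lemma C_apply (l : (j : Fin J) × Fin (n j)) (a : Fin d × Fin d) :
    S.C l a = S.P l.1 l.2 a.1 a.2 := by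
  simp [C, basisσ, Matrix.trace_single_mul]

lemma V_apply (a : Fin d × Fin d) (m : Fin M) : S.V a m = S.ρ m a.2 a.1 := rfl

lemma C_injective (x : Fin d × Fin d → ℂ) (hx : S.C.mulVec x = 0) : x = 0 := by
  refine eq_zero_of_span_eq_top S.P_complete x fun l => ?_
  have := congrFun hx l
  simp only [Matrix.mulVec, dotProduct, C_apply, Pi.zero_apply] at this
  simpa only [mul_comm] using this

lemma V_transpose_injective (x : Fin d × Fin d → ℂ) (hx : S.V.transpose.mulVec x = 0) : x = 0 := by
  have h : x ∘ Prod.swap = 0 := by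
    refine eq_zero_of_span_eq_top S.ρ_complete (x ∘ Prod.swap) fun m => ?_
    have := congrFun hx m
    simp only [Matrix.mulVec, dotProduct, Matrix.transpose_apply, V_apply, Pi.zero_apply] at this
    rw [← this, ← Equiv.sum_comp (Equiv.prodComm (Fin d) (Fin d))]
    exact Finset.sum_congr rfl fun a _ => mul_comm _ _
  ext a
  exact congrFun h a.swap

/-- The left inverse of `C`. -/
abbrev invC : Matrix (Fin d × Fin d) ((j : Fin J) × Fin (n j)) ℂ := leastSquares S.C

/-- The left inverse of `Vᵀ`. -/
abbrev invV : Matrix (Fin d × Fin d) (Fin M) ℂ := leastSquares S.V.transpose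

lemma frobNorm_invC_sq : frobNorm S.invC ^ 2 = S.trC := frobNorm_leastSquares_sq S.C_injective

lemma frobNorm_invV_sq : frobNorm S.invV ^ 2 = S.trV :=
  frobNorm_leastSquares_sq S.V_transpose_injective

lemma trC_nonneg : 0 ≤ S.trC := S.frobNorm_invC_sq ▸ sq_nonneg _

lemma trV_nonneg : 0 ≤ S.trV := S.frobNorm_invV_sq ▸ sq_nonneg _

open Matrix in
lemma leastSquares_B : leastSquares S.B =
    (kroneckerMap (· * ·) (1 : Matrix (Fin d × Fin d) (Fin d × Fin d) ℂ) S.invV).submatrix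
      (Equiv.prodProdProdComm (Fin d) (Fin d) (Fin d) (Fin d)) id := by
  set e := Equiv.prodProdProdComm (Fin d) (Fin d) (Fin d) (Fin d) with he
  -- `E_j ρ E_k†` has a single nonzero entry, `ρ j₂ k₂` at `(j₁, k₁)`. Regrouping the column index
  -- as `((k₁, j₁), (k₂, j₂))` thus exposes the tensor factor `1`.
  have hB : S.B = (kroneckerMap (· * ·) (1 : Matrix (Fin d × Fin d) (Fin d × Fin d) ℂ)
      S.V.transpose).submatrix id e := by
    ext ⟨⟨a, b⟩, m⟩ ⟨⟨k₁, k₂⟩, ⟨j₁, j₂⟩⟩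
    have h1 : (basisE (j₁, j₂) * S.ρ m * (basisE (k₁, k₂)).conjTranspose) b a =
        if j₁ = b ∧ k₁ = a then S.ρ m j₂ k₂ else 0 := by
      rw [basisE, basisE, conjTranspose_single, star_one, Matrix.single_mul_mul_single]
      simp [Matrix.single_apply]
    simp only [B, Matrix.of_apply, Matrix.vec, h1, submatrix_apply, id_eq, kroneckerMap_apply, he,
      Equiv.prodProdProdComm_apply, one_apply, transpose_apply, V_apply, Prod.mk.injEq]
    simp only [eq_comm (a := a), eq_comm (a := b)]
    by_cases hj : j₁ = b <;> by_cases hk : k₁ = a <;> simp [hj, hk]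
  rw [leastSquares, hB, conjTranspose_submatrix, conjTranspose_kronecker,
    ← Matrix.submatrix_mul _ _ e id e Function.bijective_id, ← mul_kronecker_mul,
    inv_submatrix_equiv, inv_kronecker, Matrix.submatrix_mul_equiv, ← mul_kronecker_mul]
  simp [leastSquares]

/-- The linear inversion in coordinates. -/
lemma estD_apply (p : Matrix (Fin M) ((j : Fin J) × Fin (n j)) ℂ) (j k : Fin d × Fin d) :
    S.estD p j k = ∑ m, ∑ l, S.invV (k.2, j.2) m * S.invC (k.1, j.1) l * p m l := by
  have h : S.estD p j k = ((leastSquares S.B).mulVec (S.estA p).vec) (k, j) := rfl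
  rw [h, leastSquares_B, Matrix.mulVec, dotProduct, Fintype.sum_prod_type]
  rw [Finset.sum_eq_single (k.1, j.1)]
  · refine Finset.sum_congr rfl fun m _ => ?_
    have h2 : S.estA p m (k.1, j.1) = ∑ l, S.invC (k.1, j.1) l * p m l := by
      simp [estA, leastSquares, Matrix.mul_apply]
    simp only [Matrix.submatrix_apply, Matrix.kroneckerMap_apply, Matrix.vec, h2, Finset.mul_sum,
      Equiv.prodProdProdComm_apply, Matrix.one_apply_eq, one_mul, id_eq, mul_assoc]
  · intro b _ hb
    refine Finset.sum_eq_zero fun m _ => ?_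
    simp [Matrix.one_apply_ne hb.symm]
  · simp

end Config

/-! ### Properties of the process -/

namespace Channel

variable {d : ℕ} (T : Channel d)

lemma apply_posSemidef {ρ : Op d} (hρ : ρ.PosSemidef) : (T.apply ρ).PosSemidef :=
  Matrix.posSemidef_sum _ fun _ _ => hρ.mul_mul_conjTranspose_same _

lemma trace_apply (ρ : Op d) : (T.apply ρ).trace =
    (ρ * ∑ i, (T.kraus i).conjTranspose * T.kraus i).trace := by
  rw [apply, Matrix.trace_sum, Finset.mul_sum, Matrix.trace_sum]
  refine Finset.sum_congr rfl fun i _ => ?_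
  rw [Matrix.mul_assoc, Matrix.trace_mul_comm, Matrix.mul_assoc]

end Channel

namespace IsProcessMatrix

variable {d : ℕ} {T : Channel d} {X : BiOp d} (hX : IsProcessMatrix T X)

include hX

lemma apply_entry (ρ : Op d) (a b : Fin d) :
    T.apply ρ a b = ∑ r, ∑ s, X (a, r) (b, s) * ρ r s := by
  rw [hX.apply_eq]
  have h1 : ∀ j k : Fin d × Fin d, (basisE j * ρ * (basisE k).conjTranspose) a b =
      if j.1 = a ∧ k.1 = b then ρ j.2 k.2 else 0 := by
    intro j k
    rw [basisE, basisE, Matrix.conjTranspose_single, star_one, Matrix.single_mul_mul_single]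
    simp [Matrix.single_apply]
  simp only [Matrix.sum_apply, Matrix.smul_apply, smul_eq_mul, h1, Fintype.sum_prod_type]
  rw [Finset.sum_eq_single a (fun c _ hc => by simp [hc]) (by simp)]
  refine Finset.sum_congr rfl fun r _ => ?_
  rw [Finset.sum_eq_single b (fun c _ hc => by simp [hc]) (by simp)]
  simp

/-- Paired with any `ρ` under the trace, both sides give the trace of the output. This turns trace
conditions on the process into `F ≤ 1`, or `Tr F = d` in the TP case. -/
lemma partialTrace₁_transpose :
    (partialTrace₁ X).transpose = ∑ i, (T.kraus i).conjTranspose * T.kraus i := by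
  rw [Matrix.ext_iff_trace_mul_left]
  intro ρ
  rw [← T.trace_apply]
  symm
  simp only [Matrix.trace, Matrix.diag_apply, hX.apply_entry, Matrix.mul_apply,
    Matrix.transpose_apply, partialTrace₁, Matrix.of_apply, Finset.mul_sum]
  rw [Finset.sum_comm]
  refine Finset.sum_congr rfl fun r _ => ?_
  rw [Finset.sum_comm]
  refine Finset.sum_congr rfl fun s _ => Finset.sum_congr rfl fun a _ => mul_comm _ _

lemma one_sub_partialTrace₁_posSemidef : (1 - partialTrace₁ X).PosSemidef := by
  have h := T.sum_le_one
  rw [← hX.partialTrace₁_transpose] at h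
  simpa using h.transpose

lemma trace_partialTrace₁_of_isTP (hT : T.IsTP) : (partialTrace₁ X).trace = d := by
  rw [← Matrix.trace_transpose, hX.partialTrace₁_transpose, show ∑ i, _ = _ from hT]
  simp

end IsProcessMatrix

namespace Config

variable {d M J : ℕ} {n : Fin J → ℕ} (S : Config d M J n) (T : Channel d)

/-! ### Measurement statistics -/

/-- The event `none` has probability `Tr (ρ (1 - ∑ A† A))`, nonnegative since the process does not
increase the trace. -/
lemma outcomeProb_isWeight (m : Fin M) (j : Fin J) : IsWeight (S.outcomeProb T m j) := by
  refine ⟨fun o => ?_, ?_⟩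
  · cases o with
    | some i =>
      exact (Complex.nonneg_iff.mp (trace_mul_posSemidef_nonneg
        (T.apply_posSemidef (S.ρ_posSemidef m)) (S.P_posSemidef j i))).1
    | none =>
      have h := trace_mul_posSemidef_nonneg (S.ρ_posSemidef m) T.sum_le_one
      rw [Matrix.mul_sub, Matrix.trace_sub, ← T.trace_apply, Matrix.mul_one, S.ρ_trace] at h
      simpa [outcomeProb] using (Complex.nonneg_iff.mp h).1
  · have h : ∑ i, (T.apply (S.ρ m) * S.P j i).trace.re = (T.apply (S.ρ m)).trace.re := by
      rw [← Complex.re_sum, ← Matrix.trace_sum, ← Finset.mul_sum, S.P_sum, Matrix.mul_one]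
    rw [Fintype.sum_option]
    simp only [outcomeProb, h]
    ring

lemma outcomeProb_le_one (m : Fin M) (j : Fin J) (o : Option (Fin (n j))) :
    S.outcomeProb T m j o ≤ 1 := by
  rw [← (S.outcomeProb_isWeight T m j).sum_eq_one]
  exact Finset.single_le_sum (fun o _ => (S.outcomeProb_isWeight T m j).nonneg o)
    (Finset.mem_univ o)

lemma recordProb_isWeight (N : ℕ) :
    IsWeight fun ω : Record M J n N => S.recordProb T ω :=
  IsWeight.pi fun m => IsWeight.pi fun j => IsWeight.pi fun _ => S.outcomeProb_isWeight T m j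

/-- The exact outcome probabilities. -/
def probMatrix : Matrix (Fin M) ((j : Fin J) × Fin (n j)) ℂ :=
  Matrix.of fun m l => (S.outcomeProb T m l.1 (some l.2) : ℂ)

variable {T}

/-- Linear inversion of the exact probabilities recovers the process matrix. -/
lemma estD_probMatrix {X : BiOp d} (hX : IsProcessMatrix T X) : S.estD (S.probMatrix T) = X := by
  have hp : ∀ m l, S.probMatrix T m l =
      ∑ a : Fin d × Fin d, ∑ b : Fin d × Fin d,
        X (a.2, b.2) (a.1, b.1) * S.V.transpose m b * S.C l a := by
    intro m l
    have h1 := trace_mul_posSemidef_nonneg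
        (T.apply_posSemidef (S.ρ_posSemidef m)) (S.P_posSemidef l.1 l.2)
    have h2 : S.probMatrix T m l = (T.apply (S.ρ m) * S.P l.1 l.2).trace :=
      (Complex.eq_re_of_ofReal_le h1).symm
    rw [h2]
    simp only [Matrix.trace, Matrix.diag_apply, Matrix.mul_apply, hX.apply_entry,
      Fintype.sum_prod_type, C_apply, V_apply, Matrix.transpose_apply, Finset.sum_mul]
    rw [Finset.sum_comm]
    refine Finset.sum_congr rfl fun k _ => Finset.sum_congr rfl fun j _ => ?_
    exact Finset.sum_comm
  have hV : ∀ b b', ∑ m, S.invV b m * S.V.transpose m b' = if b = b' then 1 else 0 := by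
    intro b b'
    rw [← Matrix.mul_apply, leastSquares_mul_self S.V_transpose_injective, Matrix.one_apply]
  have hC : ∀ a a', ∑ l, S.invC a l * S.C l a' = if a = a' then 1 else 0 := by
    intro a a'
    rw [← Matrix.mul_apply, leastSquares_mul_self S.C_injective, Matrix.one_apply]
  ext j k
  rw [estD_apply]
  calc _ = ∑ m, ∑ l, ∑ a : Fin d × Fin d, ∑ b : Fin d × Fin d, X (a.2, b.2) (a.1, b.1) *
        ((S.invV (k.2, j.2) m * S.V.transpose m b) * (S.invC (k.1, j.1) l * S.C l a)) := by
        simp_rw [hp, Finset.mul_sum]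
        refine Finset.sum_congr rfl fun _ _ => Finset.sum_congr rfl fun _ _ =>
          Finset.sum_congr rfl fun _ _ => Finset.sum_congr rfl fun _ _ => by ring
    _ = ∑ a : Fin d × Fin d, ∑ b : Fin d × Fin d, X (a.2, b.2) (a.1, b.1) *
        ((∑ m, S.invV (k.2, j.2) m * S.V.transpose m b) * ∑ l, S.invC (k.1, j.1) l * S.C l a) := by
        simp_rw [Finset.sum_mul_sum, Finset.mul_sum]
        simp_rw [Finset.sum_comm (s := (Finset.univ : Finset ((j : Fin J) × Fin (n j)))),
          Finset.sum_comm (s := (Finset.univ : Finset (Fin M)))]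
    _ = X j k := by
        simp_rw [hV, hC]
        rw [Finset.sum_eq_single (k.1, j.1), Finset.sum_eq_single (k.2, j.2)]
        · simp
        · intro b _ hb
          simp [hb.symm]
        · simp
        · intro b _ hb
          simp [hb.symm]
        · simp

/-- A linear statistic of the frequencies as a sum over the individual measurements. -/
lemma sum_mul_freq_sub_probMatrix (T : Channel d) {N : ℕ} (hN : N / J ≠ 0) (ω : Record M J n N)
    (u : Fin M → ((j : Fin J) × Fin (n j)) → ℂ) :
    ∑ m, ∑ l, u m l * (freq ω m l - S.probMatrix T m l) =
      ((N / J : ℕ) : ℂ)⁻¹ * ∑ m, ∑ j, ∑ c, ((ω m j c).elim 0 (fun i => u m ⟨j, i⟩) -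
        ∑ o, (S.outcomeProb T m j o : ℂ) * o.elim 0 (fun i => u m ⟨j, i⟩)) := by
  have hN' : ((N / J : ℕ) : ℂ) ≠ 0 := Nat.cast_ne_zero.mpr hN
  rw [Finset.mul_sum]
  refine Finset.sum_congr rfl fun m _ => ?_
  rw [Finset.mul_sum, Fintype.sum_sigma]
  refine Finset.sum_congr rfl fun j _ => ?_
  rw [Finset.sum_sub_distrib, Finset.sum_const, Finset.card_univ, Fintype.card_fin,
    Fintype.sum_option, nsmul_eq_mul, mul_sub, inv_mul_cancel_left₀ hN']
  simp_rw [mul_sub]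
  rw [Finset.sum_sub_distrib]
  congr 1
  · have h : ∀ c, (ω m j c).elim 0 (fun i => u m ⟨j, i⟩) =
        ∑ i, if ω m j c = some i then u m ⟨j, i⟩ else 0 := by
      intro c
      cases ω m j c <;> simp
    simp_rw [h]
    rw [Finset.sum_comm, Finset.mul_sum]
    refine Finset.sum_congr rfl fun i _ => ?_
    rw [← Finset.sum_filter, Finset.sum_const, nsmul_eq_mul]
    simp only [freq, Matrix.of_apply]
    rw [div_eq_inv_mul]
    ring
  · simp only [probMatrix, Matrix.of_apply, Option.elim, mul_zero, zero_add]
    exact Finset.sum_congr rfl fun i _ => mul_comm _ _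

/-- The second moment of a linear statistic of the frequencies. -/
lemma sum_recordProb_mul_sq_norm_le (T : Channel d) {N : ℕ} (hN : N / J ≠ 0)
    (u : Fin M → ((j : Fin J) × Fin (n j)) → ℂ) :
    ∑ ω : Record M J n N, S.recordProb T ω *
        ‖∑ m, ∑ l, u m l * (freq ω m l - S.probMatrix T m l)‖ ^ 2 ≤
      ((N / J : ℕ) : ℝ)⁻¹ * ∑ m, ∑ l : (j : Fin J) × Fin (n j),
        S.outcomeProb T m l.1 (some l.2) * ‖u m l‖ ^ 2 := by
  set g : (m : Fin M) → (j : Fin J) → Option (Fin (n j)) → ℂ :=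
    fun m j o => o.elim 0 (fun i => u m ⟨j, i⟩) with hg
  set f : (m : Fin M) → (j : Fin J) → Option (Fin (n j)) → ℂ :=
    fun m j o => g m j o - ∑ o, (S.outcomeProb T m j o : ℂ) * g m j o with hf
  have hw := S.outcomeProb_isWeight T
  -- Records form a product nested over inputs, POVM sets and copies. Centredness is passed from the
  -- innermost level outwards so that the variance formula applies at each level.
  have hf0 : ∀ m j, ∑ o, (S.outcomeProb T m j o : ℂ) * f m j o = 0 := by
    intro m j
    simp only [hf, mul_sub, Finset.sum_sub_distrib]
    rw [← Finset.sum_mul, ← Complex.ofReal_sum, (hw m j).sum_eq_one]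
    simp
  have hf1 : ∀ m j, ∑ ω : Fin (N / J) → Option (Fin (n j)),
      ((∏ c, S.outcomeProb T m j (ω c) : ℝ) : ℂ) * ∑ c, f m j (ω c) = 0 := fun m j =>
    sum_pi_weight_sum_eq_zero (ι := Fin (N / J)) (α := fun _ => Option (Fin (n j)))
      (w := fun _ => S.outcomeProb T m j) (fun _ => hw m j) (f := fun _ => f m j) fun _ => hf0 m j
  have hf2 : ∀ m, ∑ ω : (j : Fin J) → Fin (N / J) → Option (Fin (n j)),
      ((∏ j, ∏ c, S.outcomeProb T m j (ω j c) : ℝ) : ℂ) * ∑ j, ∑ c, f m j (ω j c) = 0 := fun m =>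
    sum_pi_weight_sum_eq_zero (ι := Fin J) (α := fun j => Fin (N / J) → Option (Fin (n j)))
      (w := fun j ω => ∏ c, S.outcomeProb T m j (ω c))
      (fun j => IsWeight.pi fun _ => hw m j) (f := fun j ω => ∑ c, f m j (ω c)) (hf1 m)
  have hvar : ∑ ω : Record M J n N, S.recordProb T ω * ‖∑ m, ∑ j, ∑ c, f m j (ω m j c)‖ ^ 2 =
      ∑ m, ∑ j, ∑ _c : Fin (N / J), ∑ o, S.outcomeProb T m j o * ‖f m j o‖ ^ 2 := by
    have h1 := sum_pi_weight_sq_norm_sum (ι := Fin M)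
      (α := fun _ => (j : Fin J) → Fin (N / J) → Option (Fin (n j)))
      (w := fun m ω => ∏ j, ∏ c, S.outcomeProb T m j (ω j c))
      (fun m => IsWeight.pi fun j => IsWeight.pi fun _ => hw m j)
      (f := fun m ω => ∑ j, ∑ c, f m j (ω j c))
      (fun m => hf2 m)
    refine h1.trans (Finset.sum_congr rfl fun m _ => ?_)
    have h2 := sum_pi_weight_sq_norm_sum (ι := Fin J)
      (α := fun j => Fin (N / J) → Option (Fin (n j)))
      (w := fun j ω => ∏ c, S.outcomeProb T m j (ω c))
      (fun j => IsWeight.pi fun _ => hw m j)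
      (f := fun j ω => ∑ c, f m j (ω c))
      (fun j => hf1 m j)
    refine h2.trans (Finset.sum_congr rfl fun j _ => ?_)
    exact sum_pi_weight_sq_norm_sum (ι := Fin (N / J)) (α := fun _ => Option (Fin (n j)))
      (w := fun _ => S.outcomeProb T m j) (fun _ => hw m j) (f := fun _ => f m j)
      (fun _ => hf0 m j)
  have hN' : ((N / J : ℕ) : ℝ) ≠ 0 := Nat.cast_ne_zero.mpr hN
  calc _ = ∑ ω : Record M J n N, (((N / J : ℕ) : ℝ)⁻¹) ^ 2 *
        (S.recordProb T ω * ‖∑ m, ∑ j, ∑ c, f m j (ω m j c)‖ ^ 2) := by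
        refine Finset.sum_congr rfl fun ω _ => ?_
        rw [S.sum_mul_freq_sub_probMatrix T hN, norm_mul, norm_inv, Complex.norm_natCast]
        ring
    _ = (((N / J : ℕ) : ℝ)⁻¹) ^ 2 *
        ∑ m, ∑ j, ∑ _c : Fin (N / J), ∑ o, S.outcomeProb T m j o * ‖f m j o‖ ^ 2 := by
        rw [← Finset.mul_sum, hvar]
    -- The second moment still carries the outcome probabilities, which settles the case `X = 0`
    -- later.
    _ ≤ (((N / J : ℕ) : ℝ)⁻¹) ^ 2 *
        ∑ m, ∑ j, ∑ _c : Fin (N / J), ∑ o, S.outcomeProb T m j o * ‖g m j o‖ ^ 2 := by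
        refine mul_le_mul_of_nonneg_left ?_ (by positivity)
        refine Finset.sum_le_sum fun m _ => Finset.sum_le_sum fun j _ =>
          Finset.sum_le_sum fun _ _ => ?_
        exact sum_weight_mul_sq_norm_sub_mean_le (hw m j) (g m j)
    _ = _ := by
        simp_rw [Finset.sum_const, Finset.card_univ, Fintype.card_fin, nsmul_eq_mul,
          ← Finset.mul_sum, Fintype.sum_sigma, Fintype.sum_option]
        simp only [hg, Option.elim, norm_zero]
        field_simp
        simp

/-- The mean squared error of the linear inversion. -/
lemma sum_recordProb_mul_sq_frobNorm_le {X : BiOp d} (hX : IsProcessMatrix T X) {N : ℕ}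
    (hN : N / J ≠ 0) :
    ∑ ω : Record M J n N, S.recordProb T ω * frobNorm (S.estD (freq ω) - X) ^ 2 ≤
      ((N / J : ℕ) : ℝ)⁻¹ * ∑ m, ∑ l : (j : Fin J) × Fin (n j),
        S.outcomeProb T m l.1 (some l.2) *
          ((∑ b, ‖S.invV b m‖ ^ 2) * ∑ a, ‖S.invC a l‖ ^ 2) := by
  set u : (Fin d × Fin d) → (Fin d × Fin d) → Fin M → ((j : Fin J) × Fin (n j)) → ℂ :=
    fun j k m l => S.invV (k.2, j.2) m * S.invC (k.1, j.1) l with hu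
  have h1 : ∀ (ω : Record M J n N) j k, (S.estD (freq ω) - X) j k =
      ∑ m, ∑ l, u j k m l * (freq ω m l - S.probMatrix T m l) := by
    intro ω j k
    conv_lhs => rw [← S.estD_probMatrix hX]
    rw [Matrix.sub_apply, estD_apply, estD_apply, ← Finset.sum_sub_distrib]
    refine Finset.sum_congr rfl fun m _ => ?_
    rw [← Finset.sum_sub_distrib]
    exact Finset.sum_congr rfl fun l _ => (mul_sub _ _ _).symm
  have h2 : ∀ m l, ∑ j, ∑ k, ‖u j k m l‖ ^ 2 =
      (∑ b, ‖S.invV b m‖ ^ 2) * ∑ a, ‖S.invC a l‖ ^ 2 := by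
    intro m l
    rw [Finset.sum_mul_sum, ← Fintype.sum_prod_type', ← Fintype.sum_prod_type']
    refine Fintype.sum_equiv ((Equiv.prodProdProdComm _ _ _ _).trans
      (((Equiv.prodComm _ _).prodCongr (Equiv.prodComm _ _)).trans (Equiv.prodComm _ _))) _ _
      fun x => ?_
    simp [hu, mul_pow]
  calc _ = ∑ j, ∑ k, ∑ ω : Record M J n N, S.recordProb T ω *
        ‖∑ m, ∑ l, u j k m l * (freq ω m l - S.probMatrix T m l)‖ ^ 2 := by
        simp_rw [frobNorm_sq, h1, Finset.mul_sum]
        rw [Finset.sum_comm]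
        exact Finset.sum_congr rfl fun j _ => Finset.sum_comm
    _ ≤ ∑ j, ∑ k, ((N / J : ℕ) : ℝ)⁻¹ * ∑ m, ∑ l : (j : Fin J) × Fin (n j),
        S.outcomeProb T m l.1 (some l.2) * ‖u j k m l‖ ^ 2 :=
        Finset.sum_le_sum fun j _ => Finset.sum_le_sum fun k _ =>
          S.sum_recordProb_mul_sq_norm_le T hN (u j k)
    _ = _ := by
        simp_rw [← h2, ← Finset.mul_sum]
        congr 1
        simp_rw [Finset.mul_sum]
        simp_rw [Finset.sum_comm (s := (Finset.univ : Finset (Fin d × Fin d)))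
          (t := (Finset.univ : Finset (Fin M)))]
        simp_rw [Finset.sum_comm (s := (Finset.univ : Finset (Fin d × Fin d)))
          (t := (Finset.univ : Finset ((j : Fin J) × Fin (n j))))]

/-- Bounding each probability by `1` decouples inputs from outcomes, and the double sum becomes a
product of two squared Frobenius norms. -/
lemma sum_recordProb_mul_sq_frobNorm_le_trC_trV {X : BiOp d} (hX : IsProcessMatrix T X) {N : ℕ}
    (hN : N / J ≠ 0) :
    ∑ ω : Record M J n N, S.recordProb T ω * frobNorm (S.estD (freq ω) - X) ^ 2 ≤
      ((N / J : ℕ) : ℝ)⁻¹ * (S.trC * S.trV) := by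
  refine (S.sum_recordProb_mul_sq_frobNorm_le hX hN).trans ?_
  gcongr
  calc _ ≤ ∑ m, ∑ l : (j : Fin J) × Fin (n j),
        1 * ((∑ b, ‖S.invV b m‖ ^ 2) * ∑ a, ‖S.invC a l‖ ^ 2) := by
        gcongr with m _ l _
        exact S.outcomeProb_le_one T m l.1 (some l.2)
    _ = _ := by
        simp_rw [one_mul, ← Finset.mul_sum, ← Finset.sum_mul]
        rw [Finset.sum_comm, Finset.sum_comm (γ := (j : Fin J) × Fin (n j)), ← frobNorm_sq,
          ← frobNorm_sq, frobNorm_invC_sq, frobNorm_invV_sq, mul_comm]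

end Config

namespace Config

variable {d M J : ℕ} {n : Fin J → ℕ} (S : Config d M J n) {T : Channel d} {X : BiOp d}

/-! ### The error of the two-stage estimate -/

lemma expectedError_le (hX : IsProcessMatrix T X) {N : ℕ} (hN : 1 ≤ N) {σ : ℝ} (hσ : 0 ≤ σ)
    (h : ∑ ω : Record M J n N, S.recordProb T ω * frobNorm (S.estD (freq ω) - X) ^ 2 ≤ σ ^ 2) :
    S.expectedError T X N ≤
      (2 * (Real.sqrt d * (partialTrace₁ X).trace.re) + 1) * σ + 2 * Real.sqrt d * σ ^ 2 := by
  have hw := S.recordProb_isWeight T N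
  have hτ : 0 ≤ (partialTrace₁ X).trace.re :=
    (Complex.nonneg_iff.mp (partialTrace₁_posSemidef hX.posSemidef).trace_nonneg).1
  have h1 : ∑ ω : Record M J n N, S.recordProb T ω * frobNorm (S.estD (freq ω) - X) ≤ σ :=
    (sum_weight_mul_le_sqrt hw _).trans ((Real.sqrt_le_sqrt h).trans_eq (Real.sqrt_sq hσ))
  calc S.expectedError T X N ≤ ∑ ω : Record M J n N, S.recordProb T ω *
        ((2 * (Real.sqrt d * (partialTrace₁ X).trace.re) + 1) *
          frobNorm (S.estD (freq ω) - X) +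
          2 * Real.sqrt d * frobNorm (S.estD (freq ω) - X) ^ 2) :=
        Finset.sum_le_sum fun ω _ => mul_le_mul_of_nonneg_left
          (frobNorm_correctTrace_projPSD_sub_le hX.posSemidef
            hX.one_sub_partialTrace₁_posSemidef _ hN) (hw.nonneg ω)
    _ = (2 * (Real.sqrt d * (partialTrace₁ X).trace.re) + 1) *
          ∑ ω : Record M J n N, S.recordProb T ω * frobNorm (S.estD (freq ω) - X) +
        2 * Real.sqrt d *
          ∑ ω : Record M J n N, S.recordProb T ω * frobNorm (S.estD (freq ω) - X) ^ 2 := by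
        rw [Finset.mul_sum, Finset.mul_sum, ← Finset.sum_add_distrib]
        exact Finset.sum_congr rfl fun ω _ => by ring
    _ ≤ _ := by gcongr

lemma one_le_M (S : Config d M J n) (hd : d ≠ 0) : 1 ≤ M := by
  rw [Nat.one_le_iff_ne_zero]
  rintro rfl
  have : NeZero d := ⟨hd⟩
  have h := S.ρ_complete
  rw [Set.range_eq_empty, Submodule.span_empty] at h
  exact bot_ne_top h

lemma one_le_J (S : Config d M J n) (hd : d ≠ 0) : 1 ≤ J := by
  rw [Nat.one_le_iff_ne_zero]
  rintro rfl
  have : NeZero d := ⟨hd⟩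
  have h := S.P_complete
  rw [Set.range_eq_empty, Submodule.span_empty] at h
  exact bot_ne_top h

lemma expectedError_of_dim_eq_zero (hd : d = 0) (N : ℕ) : S.expectedError T X N = 0 := by
  subst hd
  simp [expectedError, frobNorm]

/-- All registered outcomes have probability zero, so the weighted second moment vanishes and `σ =
0` is admissible. -/
lemma expectedError_zero_le (hX : IsProcessMatrix T 0) (hd : d ≠ 0) {N : ℕ} (hN : J ≤ N) :
    S.expectedError T 0 N ≤ 0 := by
  have hJ := S.one_le_J hd
  have hNJ : N / J ≠ 0 := (Nat.div_pos hN hJ).ne'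
  have hp : ∀ m j i, S.outcomeProb T m j (some i) = 0 := by
    intro m j i
    have h : T.apply (S.ρ m) = 0 := by
      ext a b
      simp [hX.apply_entry]
    simp [outcomeProb, h]
  have h := S.sum_recordProb_mul_sq_frobNorm_le hX hNJ
  simp only [hp, zero_mul, Finset.sum_const_zero, mul_zero] at h
  have h' := S.expectedError_le hX (hJ.trans hN) le_rfl (by simpa using h)
  simpa using h'

/-- The error for large `N`, without the assumption that bounds `√d Tr F` from below. -/
lemma eventually_expectedError_le (hX : IsProcessMatrix T X) (hd : d ≠ 0) :
    ∀ᶠ N : ℕ in Filter.atTop, S.expectedError T X N ≤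
      (4 * (Real.sqrt d * (partialTrace₁ X).trace.re) + 3) *
        (Real.sqrt (J * S.trC) * Real.sqrt S.trV / Real.sqrt N) := by
  have hJ := S.one_le_J hd
  set c : ℝ := Real.sqrt (J * S.trC) * Real.sqrt S.trV with hc
  have hc0 : 0 ≤ c := by positivity
  have hc2 : c ^ 2 = J * (S.trC * S.trV) := by
    rw [hc, mul_pow, Real.sq_sqrt (mul_nonneg (Nat.cast_nonneg J) S.trC_nonneg),
      Real.sq_sqrt S.trV_nonneg]
    ring
  -- With `s = c / √N` and `σ = 2 s`, the quadratic term is `8 √d s²`, at most `s` once `8 √d s ≤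
  -- 1`. Adding `2 (2 τ + 1) s`, with `τ = √d Tr F`, gives `(4 τ + 3) s`.
  have hlim : Filter.Tendsto (fun N : ℕ => 8 * Real.sqrt d * c / Real.sqrt N) Filter.atTop
      (nhds 0) :=
    tendsto_const_nhds.div_atTop (Real.tendsto_sqrt_atTop.comp tendsto_natCast_atTop_atTop)
  filter_upwards [Filter.eventually_ge_atTop J, hlim.eventually_le_const one_pos] with N hNJ hsmall
  have hN : 1 ≤ N := hJ.trans hNJ
  have hq : 1 ≤ N / J := Nat.div_pos hNJ hJ
  set s : ℝ := c / Real.sqrt N with hs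
  have hs0 : 0 ≤ s := by positivity
  have hs2 : s ^ 2 = c ^ 2 / N := by rw [hs, div_pow, Real.sq_sqrt (Nat.cast_nonneg N)]
  -- For `N ≥ J`, rounding down loses at most a factor `2`.
  have hinv : ((N / J : ℕ) : ℝ)⁻¹ ≤ 2 * J / N := by
    have h1 : N ≤ 2 * J * (N / J) := by
      have := Nat.lt_mul_div_succ N hJ
      nlinarith
    have h2 : (N : ℝ) ≤ 2 * J * (N / J : ℕ) := by exact_mod_cast h1
    have hN0 : (0 : ℝ) < N := by exact_mod_cast hN
    have hq0 : (0 : ℝ) < (N / J : ℕ) := by exact_mod_cast hq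
    rw [inv_eq_one_div, div_le_div_iff₀ hq0 hN0]
    linarith
  have hmse := S.sum_recordProb_mul_sq_frobNorm_le_trC_trV hX (Nat.one_le_iff_ne_zero.mp hq)
  have hσ : ((N / J : ℕ) : ℝ)⁻¹ * (S.trC * S.trV) ≤ (2 * s) ^ 2 := by
    calc _ ≤ 2 * J / N * (S.trC * S.trV) :=
          mul_le_mul_of_nonneg_right hinv (mul_nonneg S.trC_nonneg S.trV_nonneg)
      _ = 2 * s ^ 2 := by rw [hs2, hc2]; ring
      _ ≤ _ := by nlinarith [sq_nonneg s]
  have h := S.expectedError_le hX hN (by positivity) (hmse.trans hσ)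
  have hsmall' : 8 * Real.sqrt d * s ≤ 1 := by
    rw [hs, ← mul_div_assoc]
    exact hsmall
  nlinarith [mul_le_mul_of_nonneg_right hsmall' hs0]

lemma eventually_expectedError_le_of_le {δ : ℝ} (hδ : 0 < δ) (hX : IsProcessMatrix T X)
    (h : X = 0 ∨ δ ≤ Real.sqrt d * (partialTrace₁ X).trace.re) :
    ∀ᶠ N : ℕ in Filter.atTop, S.expectedError T X N ≤
      (4 + 3 / δ) * (Real.sqrt d * (partialTrace₁ X).trace.re * Real.sqrt (J * S.trC) *
        Real.sqrt (M * S.trV) / Real.sqrt N) := by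
  have hτ : 0 ≤ (partialTrace₁ X).trace.re :=
    (Complex.nonneg_iff.mp (partialTrace₁_posSemidef hX.posSemidef).trace_nonneg).1
  by_cases hd : d = 0
  · exact Filter.Eventually.of_forall fun N => by
      rw [S.expectedError_of_dim_eq_zero hd]
      positivity
  rcases h with rfl | h
  · filter_upwards [Filter.eventually_ge_atTop J] with N hN
    exact (S.expectedError_zero_le hX hd hN).trans (by positivity)
  · filter_upwards [S.eventually_expectedError_le hX hd] with N hN
    refine hN.trans ?_
    set τ := Real.sqrt d * (partialTrace₁ X).trace.re with hτdef
    have h1 : 4 * τ + 3 ≤ (4 + 3 / δ) * τ := by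
      have : 3 ≤ 3 / δ * τ := by
        rw [div_mul_eq_mul_div, le_div_iff₀ hδ]
        linarith
      linarith
    have h2 : Real.sqrt S.trV ≤ Real.sqrt (M * S.trV) := by
      refine Real.sqrt_le_sqrt (le_mul_of_one_le_left S.trV_nonneg ?_)
      exact_mod_cast S.one_le_M hd
    calc _ ≤ (4 + 3 / δ) * τ *
          (Real.sqrt (J * S.trC) * Real.sqrt (M * S.trV) / Real.sqrt N) := by gcongr
      _ = _ := by ring

end Config

end QPT

end

theorem theorem1 :
    (∀ δ : ℝ, 0 < δ → ∃ K : ℝ, 0 < K ∧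
      ∀ (d M J : ℕ) (n : Fin J → ℕ) (S : QPT.Config d M J n) (T : QPT.Channel d) (X : QPT.BiOp d),
        QPT.IsProcessMatrix T X →
        (X = 0 ∨ δ ≤ Real.sqrt d * (QPT.partialTrace₁ X).trace.re) →
        ∀ᶠ N : ℕ in Filter.atTop,
          S.expectedError T X N ≤
            K * (Real.sqrt d * (QPT.partialTrace₁ X).trace.re * Real.sqrt (J * S.trC) *
              Real.sqrt (M * S.trV) / Real.sqrt N)) ∧
    (∃ K : ℝ, 0 < K ∧
      ∀ (d M J : ℕ) (n : Fin J → ℕ) (S : QPT.Config d M J n) (T : QPT.Channel d) (X : QPT.BiOp d),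
        QPT.IsProcessMatrix T X → T.IsTP →
        (QPT.partialTrace₁ X).trace = d ∧
        ∀ᶠ N : ℕ in Filter.atTop,
          S.expectedError T X N ≤
            K * ((d : ℝ) ^ (3 / 2 : ℝ) * Real.sqrt (J * S.trC) *
              Real.sqrt (M * S.trV) / Real.sqrt N)) := by
  refine ⟨fun δ hδ => ⟨4 + 3 / δ, by positivity, fun d M J n S T X hX h =>
    S.eventually_expectedError_le_of_le hδ hX h⟩, 4 + 3 / 1, by norm_num,
    fun d M J n S T X hX hT => ?_⟩
  have htr := hX.trace_partialTrace₁_of_isTP hT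
  refine ⟨htr, ?_⟩
  have htr' : (QPT.partialTrace₁ X).trace.re = d := by rw [htr, Complex.natCast_re]
  have hpow : (d : ℝ) ^ (3 / 2 : ℝ) = Real.sqrt d * d := by
    rcases Nat.eq_zero_or_pos d with rfl | hd
    · norm_num
    · have hd' : (0 : ℝ) < d := by exact_mod_cast hd
      rw [Real.sqrt_eq_rpow, ← Real.rpow_add_one hd'.ne']
      norm_num
  -- For TP processes `√d Tr F = √d d ≥ 1`, so `δ = 1` yields an absolute constant; in dimension
  -- zero `X = 0`.
  have h : X = 0 ∨ 1 ≤ Real.sqrt d * (QPT.partialTrace₁ X).trace.re := by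
    rcases Nat.eq_zero_or_pos d with rfl | hd
    · exact Or.inl (Subsingleton.elim _ _)
    · have hd' : (1 : ℝ) ≤ d := by exact_mod_cast hd
      rw [htr']
      exact Or.inr (one_le_mul_of_one_le_of_one_le (Real.one_le_sqrt.mpr hd') hd')
  have hmain := S.eventually_expectedError_le_of_le one_pos hX h
  rwa [htr', ← hpow] at hmain
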